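/- **Setting (the calculus qCCS).** Fix a set $Chan$ of channel names, a countably infinite set $Var$ of quantum variables, for each $x\in Var$ a finite-dimensional complex Hilbert space $\mathcal H_x=\mathbb C^{d_x}$ ($d_x\ge 1$), and a set of process constant schemes $A$ with arities $ar(A)\in\mathbb N$. Variables $x,y$ have the same type if $\mathcal H_x=\mathcal H_y$; assume that for each $x$ there are infinitely many variables of the same type as $x$. Put $\mathcal H_X=\bigotimes_{x\in X}\mathcal H_x$ and $\mathcal H=\mathcal H_{Var}$, the latter being the Hilbert space with orthonormal basis the vectors $\bigotimes_x|s_x\rangle$ with $s_x=0$ for all but finitely many $x$. Let $\mathcal D(\mathcal H)$ be the set of positive operators on $\mathcal H$ of trace at most $1$. A super-operator on $\mathcal H_X$ is a completely positive linear map $\mathcal E$ on operators with $tr\,\mathcal E(\rho)\le tr\,\rho$ for $\rho\in\mathcal D(\mathcal H_X)$; for finite $X$ let $\mathcal E_X=\mathcal E\otimes\mathcal I$ be its extension to $\mathcal H$. Let $\mathbf X_1,\dots,\mathbf X_m$ be process variable schemes with arities $ar(\mathbf X_i)$. *Process expressions* over them are given by $$E::=A(\tilde y)\mid \mathbf X_i(\tilde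 y)\mid\mathbf{nil}\mid\tau.E\mid\mathcal E[X].E\mid c?x.E\mid c!x.E\mid E+E\mid E\|E\mid E\backslash L,$$ where each $\tilde y$ is a tuple of distinct variables of the right length, $X\subseteq Var$ is finite, $\mathcal E$ is a super-operator on $\mathcal H_X$, and $L\subseteq Chan$; one requires $x\notin fv(E)$ in $c!x.E$ and $fv(E)\cap fv(F)=\emptyset$ in $E\|F$. Here $fv(A(\tilde y))=fv(\mathbf X_i(\tilde y))=\{\tilde y\}$, $fv(\mathcal E[X].E)=fv(E)\cup X$, $fv(c?x.E)=fv(E)\setminus\{x\}$, $fv(c!x.E)=fv(E)\cup\{x\}$, and $fv$ is the union over the components in the other cases. *Processes* are process expressions without process variables. Each $A$ has a defining equation $A(\tilde x)\stackrel{def}{=}P$ with $\tilde x$ distinct variables, $P$ a process and $fv(P)\subseteq\{\tilde x\}$. A *substitution* is an injective type-preserving map $f:Var\to Var$ that is the identity off a finite set; $Pf$ is the process (determined up to renaming of bound variables) obtained by replacing free occurrences of $x$ by $f(x)$ (and $\mathcal E[X]$ by $(f\circ\mathcal E\circ f^{-1})[f(X)]$). $P\{\tilde y/\tilde x\}$ is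 $Pf$ for an $f$ with $f(x_i)=y_i$, and in particular $P\{y/x\}$ is $Pf$ for the $f$ that exchanges $x$ and $y$. A configuration is a pair $\langle P,\rho\rangle$ of a process and $\rho\in\mathcal D(\mathcal H)$. Transitions are labelled by $\tau$, $\mathcal E[X]$, $c?x$, $c!x$ and are generated by: $\langle\tau.P,\rho\rangle\xrightarrow{\tau}\langle P,\rho\rangle$; $\langle\mathcal E[X].P,\rho\rangle\xrightarrow{\mathcal E[X]}\langle P,\mathcal E_X(\rho)\rangle$; $\langle c?x.P,\rho\rangle\xrightarrow{c?y}\langle P\{y/x\},\rho\rangle$ for $y\notin fv(c?x.P)$ of the same type as $x$; $\langle c!x.P,\rho\rangle\xrightarrow{c!x}\langle P,\rho\rangle$; and, if $\langle P,\rho\rangle\xrightarrow{\alpha}\langle P',\rho'\rangle$, then $\langle P+Q,\rho\rangle\xrightarrow{\alpha}\langle P',\rho'\rangle$, $\langle P\|Q,\rho\rangle\xrightarrow{\alpha}\langle P'\|Q,\rho'\rangle$ provided $\alpha$ is not an input $c?x$ with $x\in fv(Q)$, and $\langle P\backslash L,\rho\rangle\xrightarrow{\alpha}\langle P'\backslash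 L,\rho'\rangle$ provided the channel of $\alpha$, if any, is not in $L$; if $\langle P,\rho\rangle\xrightarrow{c?x}\langle P',\rho\rangle$ and $\langle Q,\rho\rangle\xrightarrow{c!x}\langle Q',\rho\rangle$ then $\langle P\|Q,\rho\rangle\xrightarrow{\tau}\langle P'\|Q',\rho\rangle$; if $A(\tilde x)\stackrel{def}{=}P$ and $\langle P\{\tilde y/\tilde x\},\rho\rangle\xrightarrow{\alpha}\langle P',\rho'\rangle$ then $\langle A(\tilde y),\rho\rangle\xrightarrow{\alpha}\langle P',\rho'\rangle$; together with the symmetric rules for $+$ and $\|$. A symmetric relation $\mathcal R$ on configurations is a *strong bisimulation* if $\langle P,\rho\rangle\mathcal R\langle Q,\sigma\rangle$ implies: (1) whenever $\langle P,\rho\rangle\xrightarrow{\alpha}\langle P',\rho'\rangle$ with $\alpha$ not an input, then $\langle Q,\sigma\rangle\xrightarrow{\alpha}\langle Q',\sigma'\rangle$ and $\langle P',\rho'\rangle\mathcal R\langle Q',\sigma'\rangle$ for some $Q',\sigma'$; (2) whenever $\langle P,\rho\rangle\xrightarrow{c?x}\langle P',\rho\rangle$ and $x\notin fv(P)\cup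 fv(Q)$, then for some $Q'$, $\langle Q,\sigma\rangle\xrightarrow{c?x}\langle Q',\sigma\rangle$ and $\langle P'\{y/x\},\rho\rangle\mathcal R\langle Q'\{y/x\},\sigma\rangle$ for all $y\notin(fv(P')\cup fv(Q'))\setminus\{x\}$ of the same type as $x$. Write $P\sim Q$ if for every $\rho\in\mathcal D(\mathcal H)$ some strong bisimulation relates $\langle P,\rho\rangle$ and $\langle Q,\rho\rangle$. $\mathbf X_i$ is *weakly guarded* in $E$ if every occurrence of $\mathbf X_i$ in $E$ lies within a subexpression of the form $\tau.F$, $\mathcal E[X].F$, $c?x.F$ or $c!x.F$. **Proposition.** For $1\le i\le m$ let $\tilde x_i$ be a tuple of $ar(\mathbf X_i)$ distinct variables and $\mathbf E_i$ a process expression containing at most the process variable schemes $\mathbf X_1,\dots,\mathbf X_m$, such that in each occurrence $\mathbf X_j(\tilde y)$ in $\mathbf E_i$ the tuple $\tilde y$ has, entry by entry, the same types as $\tilde x_j$. Suppose each $\mathbf X_i$ is weakly guarded in each $\mathbf E_j$. Let $P_i,Q_i$ ($1\le i\le m$) be processes with $fv(P_i),fv(Q_i)\subseteq\{\tilde x_i\}$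 and, for all $i$, $$P_i\sim\mathbf E_i\{\mathbf X_j(\tilde x_j):=P_j,\ j\le m\},\qquad Q_i\sim\mathbf E_i\{\mathbf X_j(\tilde x_j):=Q_j,\ j\le m\},$$ where $\mathbf E\{\mathbf X_j(\tilde x_j):=P_j,\ j\le m\}$ is the process obtained from $\mathbf E$ by simultaneously replacing every $\mathbf X_j(\tilde y)$ with $P_j\{\tilde y/\tilde x_j\}$. Then $P_i\sim Q_i$ for all $i\le m$. -/

import Mathlib

namespace QCCS

open scoped ComplexOrder

universe u v w

/-! ## Quantum systems -/

/-- The data over which the calculus is built: channel names, a countably infinite set of quantum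
variables, for each variable `x` the dimension of its state space `H_x = ℂ^(dim x)`, and the
process constant schemes with their arities. Two variables have the same type iff their state
spaces are equal, that is, iff they have the same dimension. -/
structure Signature where
  Chan : Type u
  Var : Type v
  decVar : DecidableEq Var
  countable : Countable Var
  infinite : Infinite Var
  dim : Var → ℕ
  dim_ne_zero : ∀ x, NeZero (dim x)
  Const : Type w
  ar : Const → ℕ

attribute [instance] Signature.decVar Signature.countable Signature.infinite Signature.dim_ne_zero

variable {S : Signature}

/-- Indices of the product (computational) basis of `H_X = ⨂_{x ∈ X} H_x`. -/
abbrev Basis (S : Signature) (X : Finset S.Var) : Type _ := (x : X) → Fin (S.dim x)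

/-- Operators on `H_X`, given by their matrices in the product basis. -/
abbrev Op (S : Signature) (X : Finset S.Var) : Type _ := Matrix (Basis S X) (Basis S X) ℂ

/-- `(𝓘_R ⊗ E)(A)` for a linear map `E` on operators on `H_X`, where `H_R = ℂ^n` and `A` is an
operator on `H_R ⊗ H_X`. -/
def ampliate {X : Finset S.Var} (E : Op S X →ₗ[ℂ] Op S X) (n : ℕ)
    (A : Matrix (Fin n × Basis S X) (Fin n × Basis S X) ℂ) :
    Matrix (Fin n × Basis S X) (Fin n × Basis S X) ℂ :=
  Matrix.of fun i j => E (Matrix.of fun a b => A (i.1, a) (j.1, b)) i.2 j.2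

/-- A quantum operation `E[X]`: a finite set `X` of variables and a super-operator `E` on `H_X`,
that is, a completely positive linear map which does not increase the trace of partial density
operators. -/
@[ext]
structure QOp (S : Signature) where
  X : Finset S.Var
  E : Op S X →ₗ[ℂ] Op S X
  trace_le : ∀ ρ : Op S X, ρ.PosSemidef → ρ.trace.re ≤ 1 → (E ρ).trace.re ≤ ρ.trace.re
  completelyPositive : ∀ (n : ℕ) (A : Matrix (Fin n × Basis S X) (Fin n × Basis S X) ℂ),
    A.PosSemidef → (ampliate E n A).PosSemidef

/-- Indices of the product basis of the state space `H = ⨂_{x ∈ Var} H_x` of the environment. The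
countably infinite tensor product is the separable Hilbert space with orthonormal basis
`⨂_x |s x⟩_x`, where `s x = 0` for all but finitely many `x`. -/
def Conf (S : Signature) : Type _ := {s : (x : S.Var) → Fin (S.dim x) // {x | s x ≠ 0}.Finite}

/-- The restriction of a basis index of `H` to the variables in `X`. -/
def Conf.restrict (s : Conf S) (X : Finset S.Var) : Basis S X := fun x => s.1 x

/-- The basis index which is `a` on `X` and `s` outside `X`. -/
def Conf.update (s : Conf S) {X : Finset S.Var} (a : Basis S X) : Conf S :=
  ⟨fun x => if h : x ∈ X then a ⟨x, h⟩ else s.1 x,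
    (s.2.union X.finite_toSet).subset fun x hx => by
      by_cases h : x ∈ X
      · exact Or.inr h
      · left
        simpa [h] using hx⟩

/-- A partial density operator on `H`, given by its density matrix in the product basis. A matrix
is the matrix of a positive operator of trace at most one iff it is positive semidefinite and its
diagonal sums to at most one (such a matrix always defines a bounded, trace class operator). -/
@[ext]
structure State (S : Signature) where
  mat : Matrix (Conf S) (Conf S) ℂ
  pos : mat.PosSemidef
  summable : Summable fun s => (mat s s).re
  trace_le_one : ∑' s, (mat s s).re ≤ 1

/-- The matrix of `E_X(ρ)`, where `E_X = E ⊗ 𝓘` is the cylindric extension of `E` to `H`. -/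
def QOp.cylMat (q : QOp S) (M : Matrix (Conf S) (Conf S) ℂ) : Matrix (Conf S) (Conf S) ℂ :=
  Matrix.of fun s t =>
    q.E (Matrix.of fun a b => M (s.update a) (t.update b)) (s.restrict q.X) (t.restrict q.X)

theorem Conf.update_update (s : Conf S) {X : Finset S.Var} (a b : Basis S X) :
    (s.update a).update b = s.update b := by
  apply Subtype.ext
  funext x
  by_cases h : x ∈ X <;> simp [Conf.update, h]

theorem Conf.update_restrict (s : Conf S) (X : Finset S.Var) :
    s.update (s.restrict X) = s := by
  apply Subtype.ext
  funext x
  by_cases h : x ∈ X <;> simp [Conf.update, Conf.restrict]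

theorem Conf.restrict_update (s : Conf S) {X : Finset S.Var} (a : Basis S X) :
    (s.update a).restrict X = a := by
  funext x
  simp [Conf.update, Conf.restrict]

theorem QOp.cylMat_pos (q : QOp S) {M : Matrix (Conf S) (Conf S) ℂ} (hM : M.PosSemidef) :
    (q.cylMat M).PosSemidef := by
  have key : ∀ (n : ℕ) (g : Fin n → Conf S), ((q.cylMat M).submatrix g g).PosSemidef := by
    intro n g
    have h1 := hM.submatrix (fun p : Fin n × Basis S q.X => (g p.1).update p.2)
    have h2 := (q.completelyPositive n _ h1).submatrix (fun k => (k, (g k).restrict q.X))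
    exact h2
  constructor
  · ext s t
    exact congrFun (congrFun (key 2 ![s, t]).1 0) 1
  · intro v
    classical
    let e := v.support.equivFin
    let g : Fin v.support.card → Conf S := fun k => (e.symm k).1
    have h := (key _ g).2 (Finsupp.equivFunOnFinite.symm fun k => v (g k))
    rw [Finsupp.sum_fintype _ _ (by simp)] at h
    have e1 : ∀ F : Conf S → ℂ, ∑ k, F (g k) = ∑ s ∈ v.support, F s := by
      intro F
      rw [← Finset.sum_coe_sort v.support F]
      exact Equiv.sum_comp e.symm fun s : v.support => F s
    have e2 : ∀ k, (v.sum fun t b => star (v (g k)) * q.cylMat M (g k) t * b) =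
        (Finsupp.equivFunOnFinite.symm fun k => v (g k)).sum fun j xj =>
          star (v (g k)) * (q.cylMat M).submatrix g g k j * xj := by
      intro k
      refine (e1 fun t => star (v (g k)) * q.cylMat M (g k) t * v t).symm.trans ?_
      rw [Finsupp.sum_fintype _ _ (by simp)]
      rfl
    rw [Finsupp.sum, ← e1 fun s => v.sum fun t b => star (v s) * q.cylMat M s t * b,
      Finset.sum_congr rfl fun k _ => e2 k]
    exact h

theorem State.sum_le_one (ρ : State S) (F : Finset (Conf S)) :
    ∑ s ∈ F, (ρ.mat s s).re ≤ 1 :=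
  (ρ.summable.sum_le_tsum F fun s _ => (Complex.nonneg_iff.1 (ρ.pos.diag_nonneg (i := s))).1).trans
    ρ.trace_le_one

theorem QOp.cylMat_sum_le (q : QOp S) (ρ : State S) (F : Finset (Conf S)) :
    ∑ s ∈ F, (q.cylMat ρ.mat s s).re ≤ 1 := by
  classical
  let z : Basis S q.X := fun _ => 0
  let R : Finset (Conf S) := F.image fun s => s.update z
  let up : Conf S × Basis S q.X → Conf S := fun p => p.1.update p.2
  have inj : Set.InjOn up (R ×ˢ (Finset.univ : Finset (Basis S q.X)) : Finset _) := by
    rintro ⟨r, a⟩ hr ⟨r', a'⟩ hr' h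
    simp only [Finset.coe_product, Set.mem_prod, Finset.mem_coe] at hr hr'
    obtain ⟨s, -, rfl⟩ := Finset.mem_image.1 hr.1
    obtain ⟨s', -, rfl⟩ := Finset.mem_image.1 hr'.1
    simp only [up, Conf.update_update] at h
    have h1 : a = a' := by
      rw [← Conf.restrict_update s a, h, Conf.restrict_update]
    have h2 : s.update z = s'.update z := by
      rw [← Conf.update_update s a z, h, Conf.update_update]
    exact Prod.ext h2 h1
  have sub : F ⊆ (R ×ˢ Finset.univ).image up := by
    intro s hs
    refine Finset.mem_image.2 ⟨(s.update z, s.restrict q.X), ?_, ?_⟩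
    · exact Finset.mem_product.2 ⟨Finset.mem_image_of_mem _ hs, Finset.mem_univ _⟩
    · simp only [up, Conf.update_update, Conf.update_restrict]
  have nn : ∀ s, 0 ≤ (q.cylMat ρ.mat s s).re := fun s =>
    (Complex.nonneg_iff.1 ((q.cylMat_pos ρ.pos).diag_nonneg (i := s))).1
  let B : Conf S → Op S q.X := fun r => ρ.mat.submatrix (fun a => r.update a) (fun a => r.update a)
  have hB : ∀ r, (B r).PosSemidef := fun r => ρ.pos.submatrix _
  have hBt : ∀ r, (B r).trace.re = ∑ a : Basis S q.X, (ρ.mat (r.update a) (r.update a)).re := by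
    intro r
    simp [Matrix.trace, B]
  have hB1 : ∀ r, (B r).trace.re ≤ 1 := by
    intro r
    rw [hBt, ← Finset.sum_image (f := fun s => (ρ.mat s s).re) (g := fun a => r.update a)]
    · exact ρ.sum_le_one _
    · intro a _ b _ h
      rw [← Conf.restrict_update r a]
      simp only at h
      rw [h, Conf.restrict_update]
  calc ∑ s ∈ F, (q.cylMat ρ.mat s s).re
      ≤ ∑ s ∈ (R ×ˢ Finset.univ).image up, (q.cylMat ρ.mat s s).re :=
        Finset.sum_le_sum_of_subset_of_nonneg sub fun s _ _ => nn s
    _ = ∑ r ∈ R, ∑ a : Basis S q.X, (q.cylMat ρ.mat (r.update a) (r.update a)).re := by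
        rw [Finset.sum_image inj, Finset.sum_product]
    _ = ∑ r ∈ R, (q.E (B r)).trace.re := by
        refine Finset.sum_congr rfl fun r _ => ?_
        rw [Matrix.trace, Complex.re_sum]
        refine Finset.sum_congr rfl fun a _ => ?_
        simp only [QOp.cylMat, Matrix.of_apply, Conf.update_update, Conf.restrict_update,
          Matrix.diag_apply]
        rfl
    _ ≤ ∑ r ∈ R, (B r).trace.re :=
        Finset.sum_le_sum fun r _ => q.trace_le _ (hB r) (hB1 r)
    _ = ∑ s ∈ (R ×ˢ Finset.univ).image up, (ρ.mat s s).re := by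
        rw [Finset.sum_image inj, Finset.sum_product]
        exact Finset.sum_congr rfl fun r _ => hBt r
    _ ≤ 1 := ρ.sum_le_one _

/-- `E_X(ρ)`, where `E_X = E ⊗ 𝓘` is the cylindric extension of `E` to `H`. -/
def QOp.cyl (q : QOp S) (ρ : State S) : State S where
  mat := q.cylMat ρ.mat
  pos := q.cylMat_pos ρ.pos
  summable := summable_of_sum_le
    (fun s => (Complex.nonneg_iff.1 ((q.cylMat_pos ρ.pos).diag_nonneg (i := s))).1)
    (q.cylMat_sum_le ρ)
  trace_le_one := Real.tsum_le_of_sum_le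
    (fun s => (Complex.nonneg_iff.1 ((q.cylMat_pos ρ.pos).diag_nonneg (i := s))).1)
    (q.cylMat_sum_le ρ)

/-! ## Substitutions of quantum variables -/

/-- A substitution: a one-to-one map from `Var` into itself which preserves types and is the
identity outside a finite set (and which is therefore a bijection). -/
@[ext]
structure Subst (S : Signature) where
  perm : Equiv.Perm S.Var
  dim_eq : ∀ x, S.dim (perm x) = S.dim x
  finite : {x | perm x ≠ x}.Finite

instance : CoeFun (Subst S) fun _ => S.Var → S.Var := ⟨fun f => f.perm⟩

/-- The identity substitution. -/
def Subst.id (S : Signature) : Subst S where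
  perm := Equiv.refl _
  dim_eq _ := rfl
  finite := by simp

/-- The substitution `{y/x}`, which exchanges two variables `x` and `y` of the same type. -/
def Subst.swap (x y : S.Var) (h : S.dim y = S.dim x) : Subst S where
  perm := Equiv.swap x y
  dim_eq z := by
    rcases eq_or_ne z x with rfl | hx
    · simp [h]
    · rcases eq_or_ne z y with rfl | hy
      · simp [h]
      · rw [Equiv.swap_apply_of_ne_of_ne hx hy]
  finite := (Set.toFinite {x, y}).subset fun z hz => by
    by_contra hc
    simp only [Set.mem_insert_iff, Set.mem_singleton_iff, not_or] at hc
    exact hz (Equiv.swap_apply_of_ne_of_ne hc.1 hc.2)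

/-- The composition `x ↦ g (f x)`. -/
def Subst.trans (f g : Subst S) : Subst S where
  perm := f.perm.trans g.perm
  dim_eq x := (g.dim_eq _).trans (f.dim_eq _)
  finite := (f.finite.union g.finite).subset fun x hx => by
    by_contra hc
    have h1 : f.perm x = x := not_not.1 fun h => hc (Or.inl h)
    have h2 : g.perm x = x := not_not.1 fun h => hc (Or.inr h)
    exact hx ((congrArg g.perm h1).trans h2)

theorem Subst.exists_renaming {n : ℕ} (x y : Fin n → S.Var) (hx : Function.Injective x)
    (hy : Function.Injective y) (h : ∀ i, S.dim (y i) = S.dim (x i)) :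
    ∃ f : Subst S, ∀ i, f (x i) = y i := by
  induction n with
  | zero => exact ⟨Subst.id S, fun i => i.elim0⟩
  | succ n ih =>
    obtain ⟨f, hf⟩ := ih (x ∘ Fin.castSucc) (y ∘ Fin.castSucc)
      (hx.comp (Fin.castSucc_injective n)) (hy.comp (Fin.castSucc_injective n)) fun i => h _
    refine ⟨f.trans (Subst.swap (f (x (Fin.last n))) (y (Fin.last n))
      ((h _).trans (f.dim_eq _).symm)), fun i => ?_⟩
    refine Fin.lastCases ?_ (fun j => ?_) i
    · simp [Subst.trans, Subst.swap]
    · have hj : f (x j.castSucc) = y j.castSucc := hf j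
      have h1 : y j.castSucc ≠ y (Fin.last n) := fun e => (Fin.castSucc_lt_last j).ne (hy e)
      have h2 : y j.castSucc ≠ f (x (Fin.last n)) := fun e =>
        (Fin.castSucc_lt_last j).ne (hx (f.perm.injective (hj.trans e)))
      change Equiv.swap _ _ (f (x j.castSucc)) = _
      rw [hj, Equiv.swap_apply_of_ne_of_ne h2 h1]

open Classical in
/-- A substitution `{y₁/x₁, …, yₙ/xₙ}`, that is, some `f` with `f xᵢ = yᵢ` for all `i`. It exists
whenever `x` and `y` are tuples of distinct variables of matching types; only its values at
the `xᵢ` matter when it is applied to a process whose free variables are among the `xᵢ`. -/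
noncomputable def Subst.renaming {n : ℕ} (x y : Fin n → S.Var) : Subst S :=
  if h : ∃ f : Subst S, ∀ i, f (x i) = y i then h.choose else Subst.id S

theorem Subst.renaming_apply {n : ℕ} (x y : Fin n → S.Var) (hx : Function.Injective x)
    (hy : Function.Injective y) (h : ∀ i, S.dim (y i) = S.dim (x i)) (i : Fin n) :
    Subst.renaming x y (x i) = y i := by
  have hex := Subst.exists_renaming x y hx hy h
  rw [Subst.renaming, dif_pos hex]
  exact hex.choose_spec i

/-- The bijection between the product bases of `H_X` and `H_{f(X)}` induced by `f`. -/
def Subst.basisEquiv (f : Subst S) (X : Finset S.Var) :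
    Basis S X ≃ Basis S (X.map f.perm.toEmbedding) where
  toFun a y := Fin.cast (by rw [← f.dim_eq]; simp)
    (a ⟨f.perm.symm y, by obtain ⟨x, hx, h⟩ := Finset.mem_map.1 y.2; simpa [← h] using hx⟩)
  invFun b x := Fin.cast (f.dim_eq x) (b ⟨f x, Finset.mem_map_of_mem _ x.2⟩)
  left_inv a := by
    have key : ∀ x x' : X, x = x' → (a x : ℕ) = a x' := by
      rintro x _ rfl
      rfl
    funext x
    apply Fin.ext
    exact key ⟨f.perm.symm (f.perm x), _⟩ x (Subtype.ext (f.perm.symm_apply_apply x))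
  right_inv b := by
    have key : ∀ y y' : X.map f.perm.toEmbedding, y = y' → (b y : ℕ) = b y' := by
      rintro y _ rfl
      rfl
    funext y
    apply Fin.ext
    exact key ⟨f.perm (f.perm.symm y), _⟩ y (Subtype.ext (f.perm.apply_symm_apply y))

/-- `(Ef)[f(X)]`, where `Ef = f|_X ∘ E ∘ (f|_X)⁻¹` is a super-operator on `H_{f(X)}`. -/
def QOp.subst (f : Subst S) (q : QOp S) : QOp S where
  X := q.X.map f.perm.toEmbedding
  E := (Matrix.reindexLinearEquiv ℂ ℂ (f.basisEquiv q.X) (f.basisEquiv q.X)).toLinearMap ∘ₗ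
    q.E ∘ₗ (Matrix.reindexLinearEquiv ℂ ℂ (f.basisEquiv q.X) (f.basisEquiv q.X)).symm.toLinearMap
  trace_le ρ hρ h1 := by
    have ht : ∀ A : Op S q.X, ((Matrix.reindexLinearEquiv ℂ ℂ (f.basisEquiv q.X)
        (f.basisEquiv q.X)) A).trace = A.trace := fun A =>
      Equiv.sum_comp (f.basisEquiv q.X).symm fun a => A a a
    have ht' : ((Matrix.reindexLinearEquiv ℂ ℂ (f.basisEquiv q.X)
        (f.basisEquiv q.X)).symm ρ).trace = ρ.trace :=
      Equiv.sum_comp (f.basisEquiv q.X) fun a => ρ a a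
    simp only [LinearMap.comp_apply, LinearEquiv.coe_coe]
    rw [ht, ← ht']
    exact q.trace_le _ (hρ.submatrix _) (by rw [ht']; exact h1)
  completelyPositive n A hA := by
    have h := q.completelyPositive n _
      (hA.submatrix fun p : Fin n × Basis S q.X => (p.1, f.basisEquiv q.X p.2))
    exact h.submatrix fun p : Fin n × Basis S (q.X.map f.perm.toEmbedding) =>
      (p.1, (f.basisEquiv q.X).symm p.2)

/-! ## Syntax -/

/-- Raw process expressions over a family of process variable schemes `𝐗_i` (`i : I`) with
arities `ar i`. The formation conditions are stated in `Expr.WF`. -/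
inductive Expr (S : Signature) {I : Type} (ar : I → ℕ) : Type _
  | const (A : S.Const) (y : Fin (S.ar A) → S.Var) : Expr S ar
  | pvar (i : I) (y : Fin (ar i) → S.Var) : Expr S ar
  | nil : Expr S ar
  | tau (E : Expr S ar) : Expr S ar
  | op (q : QOp S) (E : Expr S ar) : Expr S ar
  | inp (c : S.Chan) (x : S.Var) (E : Expr S ar) : Expr S ar
  | out (c : S.Chan) (x : S.Var) (E : Expr S ar) : Expr S ar
  | sum (E F : Expr S ar) : Expr S ar
  | par (E F : Expr S ar) : Expr S ar
  | res (E : Expr S ar) (L : Set S.Chan) : Expr S ar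

namespace Expr

variable {I : Type} {ar : I → ℕ}

/-- The free quantum variables of an expression. -/
def fv : Expr S ar → Set S.Var
  | const _ y => Set.range y
  | pvar _ y => Set.range y
  | nil => ∅
  | tau E => E.fv
  | op q E => E.fv ∪ (q.X : Set S.Var)
  | inp _ x E => E.fv \ {x}
  | out _ x E => E.fv ∪ {x}
  | sum E F => E.fv ∪ F.fv
  | par E F => E.fv ∪ F.fv
  | res E _ => E.fv

/-- The formation rules of process expressions. -/
def WF : Expr S ar → Prop
  | const _ y => Function.Injective y
  | pvar _ y => Function.Injective y
  | nil => True
  | tau E => E.WF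
  | op _ E => E.WF
  | inp _ _ E => E.WF
  | out _ x E => E.WF ∧ x ∉ E.fv
  | sum E F => E.WF ∧ F.WF
  | par E F => E.WF ∧ F.WF ∧ E.fv ∩ F.fv = ∅
  | res E _ => E.WF

/-- `Ef`. Since `f` is one-to-one, bound variables may be renamed along `f` as well: no free
variable is captured, and the result agrees up to alpha-conversion with the one obtained by
substituting for the free occurrences only, after choosing fresh bound variables. -/
def subst (f : Subst S) : Expr S ar → Expr S ar
  | const A y => const A fun k => f (y k)
  | pvar i y => pvar i fun k => f (y k)
  | nil => nil
  | tau E => tau (E.subst f)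
  | op q E => op (q.subst f) (E.subst f)
  | inp c x E => inp c (f x) (E.subst f)
  | out c x E => out c (f x) (E.subst f)
  | sum E F => sum (E.subst f) (F.subst f)
  | par E F => par (E.subst f) (F.subst f)
  | res E L => res (E.subst f) L

/-- `𝐗_i` is weakly guarded in `E`: every occurrence of `𝐗_i` in `E` is within a subexpression
of the form `α.F`. -/
def WeaklyGuarded (i : I) : Expr S ar → Prop
  | const _ _ => True
  | pvar j _ => j ≠ i
  | nil => True
  | tau _ => True
  | op _ _ => True
  | inp _ _ _ => True
  | out _ _ _ => True
  | sum E F => E.WeaklyGuarded i ∧ F.WeaklyGuarded i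
  | par E F => E.WeaklyGuarded i ∧ F.WeaklyGuarded i
  | res E _ => E.WeaklyGuarded i

/-- In every occurrence `𝐗_i(y)` in the expression, `y` matches the types of the formal parameters
`x i`, so that `P{y/x}` makes sense. -/
def Typed (x : (i : I) → Fin (ar i) → S.Var) : Expr S ar → Prop
  | const _ _ => True
  | pvar i y => ∀ k, S.dim (y k) = S.dim (x i k)
  | nil => True
  | tau E => E.Typed x
  | op _ E => E.Typed x
  | inp _ _ E => E.Typed x
  | out _ _ E => E.Typed x
  | sum E F => E.Typed x ∧ F.Typed x
  | par E F => E.Typed x ∧ F.Typed x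
  | res E _ => E.Typed x

theorem fv_subst (f : Subst S) (E : Expr S ar) : (E.subst f).fv = f '' E.fv := by
  induction E with
  | const A y => exact Set.range_comp f y
  | pvar i y => exact Set.range_comp f y
  | nil => simp [subst, fv]
  | tau E ih => simpa [subst, fv] using ih
  | op q E ih => simp [subst, fv, ih, QOp.subst, Set.image_union]
  | inp c x E ih => simp [subst, fv, ih, Set.image_sdiff f.perm.injective]
  | out c x E ih => simp [subst, fv, ih, Set.image_insert_eq]
  | sum E F ih1 ih2 => simp [subst, fv, ih1, ih2, Set.image_union]
  | par E F ih1 ih2 => simp [subst, fv, ih1, ih2, Set.image_union]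
  | res E L ih => simpa [subst, fv] using ih

theorem WF.subst (f : Subst S) {E : Expr S ar} (h : E.WF) : (E.subst f).WF := by
  induction E with
  | const A y => exact f.perm.injective.comp h
  | pvar i y => exact f.perm.injective.comp h
  | nil => trivial
  | tau E ih => exact ih h
  | op q E ih => exact ih h
  | inp c x E ih => exact ih h
  | out c x E ih =>
    refine ⟨ih h.1, ?_⟩
    rw [fv_subst]
    rintro ⟨z, hz, e⟩
    exact h.2 (f.perm.injective e ▸ hz)
  | sum E F ih1 ih2 => exact ⟨ih1 h.1, ih2 h.2⟩
  | par E F ih1 ih2 =>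
    refine ⟨ih1 h.1, ih2 h.2.1, ?_⟩
    rw [fv_subst, fv_subst, ← Set.image_inter f.perm.injective, h.2.2, Set.image_empty]
  | res E L ih => exact ih h

end Expr

/-- Proc expressions containing at most the process variable schemes `𝐗_i`, `i : I`. -/
def Expression (S : Signature) {I : Type} (ar : I → ℕ) : Type _ := {E : Expr S ar // E.WF}

/-- Raw processes: expressions without process variables. -/
abbrev Term (S : Signature) : Type _ := Expr S (fun i : Empty => (i.elim : ℕ))

/-- Quantum processes. -/
def Proc (S : Signature) : Type _ := {P : Term S // P.WF}

/-- The free quantum variables of a process. -/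
def Proc.fv (P : Proc S) : Set S.Var := P.1.fv

/-- `Pf`. -/
def Proc.subst (f : Subst S) (P : Proc S) : Proc S := ⟨P.1.subst f, P.2.subst f⟩

/-- `E{𝐗_i(x_i) := P_i, i : I}` on raw expressions: every `𝐗_i(y)` is replaced by `P_i{y/x_i}`. -/
noncomputable def Expr.replace {I : Type} {ar : I → ℕ} (x : (i : I) → Fin (ar i) → S.Var)
    (P : I → Proc S) : Expr S ar → Term S
  | const A y => const A y
  | pvar i y => (P i).1.subst (Subst.renaming (x i) y)
  | nil => nil
  | tau E => tau (E.replace x P)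
  | op q E => op q (E.replace x P)
  | inp c z E => inp c z (E.replace x P)
  | out c z E => out c z (E.replace x P)
  | sum E F => sum (E.replace x P) (F.replace x P)
  | par E F => par (E.replace x P) (F.replace x P)
  | res E L => res (E.replace x P) L

section replace

variable {I : Type} {ar : I → ℕ} {x : (i : I) → Fin (ar i) → S.Var} {P : I → Proc S}

theorem Expr.fv_replace_subset (hx : ∀ i, Function.Injective (x i))
    (hP : ∀ i, (P i).fv ⊆ Set.range (x i)) {E : Expr S ar} (h : E.WF) (ht : E.Typed x) :
    (E.replace x P).fv ⊆ E.fv := by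
  induction E with
  | const A y => exact subset_rfl
  | pvar i y =>
    simp only [replace, fv_subst]
    rintro _ ⟨z, hz, rfl⟩
    obtain ⟨k, rfl⟩ := hP i hz
    exact ⟨k, (Subst.renaming_apply (x i) y (hx i) h ht k).symm⟩
  | nil => exact subset_rfl
  | tau E ih => exact ih h ht
  | op q E ih => exact Set.union_subset_union_left _ (ih h ht)
  | inp c z E ih => exact Set.sdiff_subset_sdiff_left (ih h ht)
  | out c z E ih => exact Set.union_subset_union_left _ (ih h.1 ht)
  | sum E F ih1 ih2 => exact Set.union_subset_union (ih1 h.1 ht.1) (ih2 h.2 ht.2)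
  | par E F ih1 ih2 => exact Set.union_subset_union (ih1 h.1 ht.1) (ih2 h.2.1 ht.2)
  | res E L ih => exact ih h ht

theorem Expr.wf_replace (hx : ∀ i, Function.Injective (x i))
    (hP : ∀ i, (P i).fv ⊆ Set.range (x i)) {E : Expr S ar} (h : E.WF) (ht : E.Typed x) :
    (E.replace x P).WF := by
  induction E with
  | const A y => exact h
  | pvar i y => exact (P i).2.subst _
  | nil => trivial
  | tau E ih => exact ih h ht
  | op q E ih => exact ih h ht
  | inp c z E ih => exact ih h ht
  | out c z E ih => exact ⟨ih h.1 ht, fun hz => h.2 (fv_replace_subset hx hP h.1 ht hz)⟩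
  | sum E F ih1 ih2 => exact ⟨ih1 h.1 ht.1, ih2 h.2 ht.2⟩
  | par E F ih1 ih2 =>
    refine ⟨ih1 h.1 ht.1, ih2 h.2.1 ht.2, ?_⟩
    rw [← Set.disjoint_iff_inter_eq_empty]
    exact (Set.disjoint_iff_inter_eq_empty.2 h.2.2).mono
      (fv_replace_subset hx hP h.1 ht.1) (fv_replace_subset hx hP h.2.1 ht.2)
  | res E L ih => exact ih h ht

end replace

/-- The process `E{𝐗_i(x_i) := P_i, i : I}`, where each `x i` is a tuple of distinct variables,
`fv(P_i) ⊆ {x_i}`, and the occurrences of the `𝐗_i` in `E` respect the types of the `x i`. -/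
noncomputable def Expression.replace {I : Type} {ar : I → ℕ} (E : Expression S ar)
    (x : (i : I) → Fin (ar i) → S.Var) (hx : ∀ i, Function.Injective (x i)) (ht : E.1.Typed x)
    (P : I → Proc S) (hP : ∀ i, (P i).fv ⊆ Set.range (x i)) : Proc S :=
  ⟨E.1.replace x P, Expr.wf_replace hx hP E.2 ht⟩

/-! ## Operational semantics -/

/-- The defining equations `A(x) ≝ P`, with `fv(P) ⊆ {x}`, one for each process constant scheme. -/
structure Definitions (S : Signature) where
  params : (A : S.Const) → Fin (S.ar A) → S.Var
  params_injective : ∀ A, Function.Injective (params A)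
  body : S.Const → Proc S
  fv_body : ∀ A, (body A).fv ⊆ Set.range (params A)

/-- Actions. -/
inductive Act (S : Signature) : Type _
  | tau : Act S
  | op (q : QOp S) : Act S
  | inp (c : S.Chan) (x : S.Var) : Act S
  | out (c : S.Chan) (x : S.Var) : Act S

/-- The action is an input `c?x`. -/
def Act.IsInput : Act S → Prop
  | inp _ _ => True
  | _ => False

/-- The channel name in an action, if there is one. -/
def Act.cn : Act S → Option S.Chan
  | tau => none
  | op _ => none
  | inp c _ => some c
  | out c _ => some c

/-- The transition relation: `Step D P ρ α P' ρ'` means `⟨P, ρ⟩ --α--> ⟨P', ρ'⟩`. -/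
inductive Step (D : Definitions S) : Term S → State S → Act S → Term S → State S → Prop
  | tau (P ρ) : Step D (.tau P) ρ .tau P ρ
  | oper (q P ρ) : Step D (.op q P) ρ (.op q) P (q.cyl ρ)
  | input (c x P ρ y) (hd : S.dim y = S.dim x) (hy : y ∉ (Expr.inp c x P : Term S).fv) :
      Step D (.inp c x P) ρ (.inp c y) (P.subst (Subst.swap x y hd)) ρ
  | output (c x P ρ) : Step D (.out c x P) ρ (.out c x) P ρ
  | choiceL {P Q P' ρ ρ' α} : Step D P ρ α P' ρ' → Step D (.sum P Q) ρ α P' ρ'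
  | choiceR {P Q Q' ρ ρ' α} : Step D Q ρ α Q' ρ' → Step D (.sum P Q) ρ α Q' ρ'
  | intl1L {P Q P' ρ ρ' c x} : Step D P ρ (.inp c x) P' ρ' → x ∉ Q.fv →
      Step D (.par P Q) ρ (.inp c x) (.par P' Q) ρ'
  | intl1R {P Q Q' ρ ρ' c x} : Step D Q ρ (.inp c x) Q' ρ' → x ∉ P.fv →
      Step D (.par P Q) ρ (.inp c x) (.par P Q') ρ'
  | intl2L {P Q P' ρ ρ' α} : Step D P ρ α P' ρ' → ¬ α.IsInput →
      Step D (.par P Q) ρ α (.par P' Q) ρ'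
  | intl2R {P Q Q' ρ ρ' α} : Step D Q ρ α Q' ρ' → ¬ α.IsInput →
      Step D (.par P Q) ρ α (.par P Q') ρ'
  | commL {P Q P' Q' ρ c x} : Step D P ρ (.inp c x) P' ρ → Step D Q ρ (.out c x) Q' ρ →
      Step D (.par P Q) ρ .tau (.par P' Q') ρ
  | commR {P Q P' Q' ρ c x} : Step D P ρ (.out c x) P' ρ → Step D Q ρ (.inp c x) Q' ρ →
      Step D (.par P Q) ρ .tau (.par P' Q') ρ
  | res {P P' ρ ρ' α L} : Step D P ρ α P' ρ' → (∀ c, α.cn = some c → c ∉ L) →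
      Step D (.res P L) ρ α (.res P' L) ρ'
  | defn {A y P' ρ ρ' α} (f : Subst S) : (∀ k, f (D.params A k) = y k) →
      Step D ((D.body A).1.subst f) ρ α P' ρ' → Step D (.const A y) ρ α P' ρ'

/-! ## Strong bisimilarity -/

/-- Configurations `⟨P, ρ⟩`. -/
abbrev Config (S : Signature) : Type _ := Proc S × State S

/-- Strong bisimulations on configurations. In the second clause `y` ranges over the variables for
which `{y/x}` is a substitution, that is, those of the same type as `x`. -/
def IsStrongBisim (D : Definitions S) (R : Config S → Config S → Prop) : Prop :=
  (∀ C C', R C C' → R C' C) ∧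
  ∀ (P Q : Proc S) (ρ σ : State S), R (P, ρ) (Q, σ) →
    (∀ (α : Act S) (P' : Proc S) (ρ' : State S), ¬ α.IsInput → Step D P.1 ρ α P'.1 ρ' →
      ∃ (Q' : Proc S) (σ' : State S), Step D Q.1 σ α Q'.1 σ' ∧ R (P', ρ') (Q', σ')) ∧
    (∀ (c : S.Chan) (x : S.Var) (P' : Proc S), Step D P.1 ρ (.inp c x) P'.1 ρ →
      x ∉ P.fv ∪ Q.fv →
      ∃ Q' : Proc S, Step D Q.1 σ (.inp c x) Q'.1 σ ∧
        ∀ (y : S.Var) (hd : S.dim y = S.dim x), y ∉ (P'.fv ∪ Q'.fv) \ {x} →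
          R (P'.subst (Subst.swap x y hd), ρ) (Q'.subst (Subst.swap x y hd), σ))

/-- Strong bisimilarity of configurations. -/
def ConfigBisimilar (D : Definitions S) (C C' : Config S) : Prop :=
  ∃ R, IsStrongBisim D R ∧ R C C'

/-- Strong bisimilarity of processes, `P ∼ Q`. -/
def Bisimilar (D : Definitions S) (P Q : Proc S) : Prop :=
  ∀ ρ : State S, ConfigBisimilar D (P, ρ) (Q, ρ)

end QCCS

namespace QCCS

universe u v w

variable {S : Signature.{u, v, w}}

/-! ## Substitutions -/

/-! Transitions never inspect the state of the environment: the label alone determines how the state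
changes, and strong bisimulations as defined here do not compare states. Everything therefore
reduces to a labelled transition system on terms (`Step.trans`, `Trans.step`), on which
substitutions act as symmetries (`Trans.subst`).

Let `B` consist of the pairs that are bisimilar in some states, the pairs (P_j, Q_j) and their
reverses, and close it to a transitive congruence stable under substitution and alpha-conversion
(`CongrClosure`). It is enough that both terms of each `B`-pair match each other's transitions with
residuals in the closure. The same then holds for all well-formed terms related by the closure
(`CongrClosure.simulated`), and the closure, with states ignored, is a strong bisimulation
(`CongrClosure.configBisimilar`). Bisimilar pairs have this property by definition. For (P_j, Q_j)
one composes P_j ∼ E_j{P}, the passage from E_j{P} to E_j{Q}, and E_j{Q} ∼ Q_j. Weak guardedness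
enters only in the middle: the first transition never comes from inside a substituted process, so
E_j{Q} can copy it with a congruent residual (`Simulated.replace`).

Two points are peculiar to quantum variables. Inputs are matched only for variables free on neither
side, while in a composition such a variable may be free in the middle term; the input is then
renamed to a globally fresh variable and back (`Trans.rename_input`, `Simulated.trans`). And
parallel components have disjoint free variables, an invariant of transitions (`Trans.wf_and_fv`),
which makes a communicated variable fresh for the receiver (`Simulated.par`). -/

/-- The inverse substitution. -/
def Subst.symm (f : Subst S) : Subst S where
  perm := f.perm.symm
  dim_eq x := by rw [← f.dim_eq, f.perm.apply_symm_apply]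
  finite := f.finite.subset fun x hx h => hx (by
    change f.perm.symm x = x
    rw [Equiv.symm_apply_eq, h])

@[simp]
theorem Subst.id_apply (x : S.Var) : Subst.id S x = x := rfl

@[simp]
theorem Subst.trans_apply (f g : Subst S) (x : S.Var) : f.trans g x = g (f x) := rfl

@[simp]
theorem Subst.symm_apply_apply (f : Subst S) (x : S.Var) : f.symm (f x) = x :=
  f.perm.symm_apply_apply x

@[simp]
theorem Subst.apply_symm_apply (f : Subst S) (x : S.Var) : f (f.symm x) = x :=
  f.perm.apply_symm_apply x

theorem Subst.injective (f : Subst S) : Function.Injective f := f.perm.injective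

theorem Subst.ext_apply {f g : Subst S} (h : ∀ x, f x = g x) : f = g :=
  Subst.ext (Equiv.ext h)

theorem Subst.swap_apply (x y z : S.Var) (h : S.dim y = S.dim x) :
    Subst.swap x y h z = if z = x then y else if z = y then x else z :=
  Equiv.swap_apply_def x y z

theorem Subst.trans_symm (f : Subst S) : f.trans f.symm = Subst.id S :=
  Subst.ext_apply fun x => by simp

theorem Subst.symm_trans (f : Subst S) : f.symm.trans f = Subst.id S :=
  Subst.ext_apply fun x => by simp

theorem Subst.swap_self (x : S.Var) (h : S.dim x = S.dim x) : Subst.swap x x h = Subst.id S :=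
  Subst.ext_apply fun z => by simp +contextual [Subst.swap_apply]

theorem Subst.swap_trans_swap (x y : S.Var) (h : S.dim y = S.dim x) :
    (Subst.swap x y h).trans (Subst.swap y x h.symm) = Subst.id S :=
  Subst.ext_apply fun z => by
    simp only [Subst.trans_apply, Subst.swap_apply, Subst.id_apply]
    split_ifs <;> simp_all

/-- Conjugating a transposition transposes the images; this is what makes the input rule
equivariant. -/
theorem Subst.swap_trans (x y : S.Var) (h : S.dim y = S.dim x) (f : Subst S)
    (h' : S.dim (f y) = S.dim (f x)) :
    (Subst.swap x y h).trans f = f.trans (Subst.swap (f x) (f y) h') :=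
  Subst.ext_apply fun z => by
    simp only [Subst.trans_apply, Subst.swap_apply, f.injective.eq_iff]
    split_ifs <;> rfl

/-! ## Functoriality of substitution -/

/-- Basis indices of equal systems. -/
def Basis.cast {X Y : Finset S.Var} (h : X = Y) (a : Basis S X) : Basis S Y :=
  fun x => a ⟨x, (Finset.ext_iff.1 h x).2 x.2⟩

/-- The two maps live on different types when the variable sets are only propositionally equal.
Comparing matrix entries through `Basis.cast` avoids heterogeneous equality. -/
theorem QOp.ext_of_entries {q r : QOp S} (h : q.X = r.X)
    (hE : ∀ A a b, q.E A a b =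
      r.E (Matrix.of fun i j => A (Basis.cast h.symm i) (Basis.cast h.symm j))
        (Basis.cast h a) (Basis.cast h b)) : q = r := by
  obtain ⟨X, E, h1, h2⟩ := q
  obtain ⟨Y, F, h3, h4⟩ := r
  obtain rfl : X = Y := h
  have : E = F := LinearMap.ext fun A => Matrix.ext fun a b => hE A a b
  subst this
  rfl

theorem Subst.val_basisEquiv (f : Subst S) (X : Finset S.Var) (a : Basis S X) (x : X)
    (y : X.map f.perm.toEmbedding) (h : f x = y) : (f.basisEquiv X a y : ℕ) = a x := by
  have key : ∀ x x' : X, x = x' → (a x : ℕ) = a x' := by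
    rintro x _ rfl
    rfl
  refine key ⟨f.perm.symm y, _⟩ x (Subtype.ext ?_)
  simp [← h]

theorem Subst.basisEquiv_of_fix (f : Subst S) (X : Finset S.Var) (hf : ∀ x ∈ X, f x = x)
    (h : X = X.map f.perm.toEmbedding) (a : Basis S X) : f.basisEquiv X a = Basis.cast h a := by
  funext y
  have hy : (y : S.Var) ∈ X := (Finset.ext_iff.1 h y).2 y.2
  exact Fin.ext (f.val_basisEquiv X a ⟨y, hy⟩ y (hf y hy))

theorem Subst.basisEquiv_trans (f g : Subst S) (X : Finset S.Var)
    (h : X.map (f.trans g).perm.toEmbedding =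
      (X.map f.perm.toEmbedding).map g.perm.toEmbedding) (a : Basis S X) :
    g.basisEquiv _ (f.basisEquiv X a) = Basis.cast h ((f.trans g).basisEquiv X a) := by
  funext y
  obtain ⟨z, hz, e⟩ := Finset.mem_map.1 y.2
  obtain ⟨x, hx, rfl⟩ := Finset.mem_map.1 hz
  apply Fin.ext
  rw [g.val_basisEquiv _ _ ⟨_, hz⟩ y e, f.val_basisEquiv X a ⟨x, hx⟩ _ rfl]
  exact ((f.trans g).val_basisEquiv X a ⟨x, hx⟩ ⟨y, _⟩ e).symm

theorem QOp.subst_of_fix (f : Subst S) (q : QOp S) (hf : ∀ x ∈ q.X, f x = x) :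
    q.subst f = q := by
  have hX : q.X = (q.subst f).X := by
    refine (Finset.eq_of_subset_of_card_le (fun y hy => ?_) (Finset.card_map _).ge).symm
    obtain ⟨x, hx, rfl⟩ := Finset.mem_map.1 hy
    exact (hf x hx).symm ▸ hx
  have e : ∀ a, (f.basisEquiv q.X).symm a = Basis.cast hX.symm a := fun a => by
    rw [Equiv.symm_apply_eq, f.basisEquiv_of_fix q.X hf hX]
    rfl
  refine QOp.ext_of_entries hX.symm fun A a b => ?_
  exact congr (congr (congrArg (fun M : Op S q.X => (q.E M : Basis S q.X → Basis S q.X → ℂ))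
    (funext fun i => funext fun j => congrArg₂ A (f.basisEquiv_of_fix q.X hf hX i)
      (f.basisEquiv_of_fix q.X hf hX j))) (e a)) (e b)

theorem QOp.subst_subst (f g : Subst S) (q : QOp S) :
    (q.subst f).subst g = q.subst (f.trans g) := by
  have hX : (q.subst (f.trans g)).X = ((q.subst f).subst g).X :=
    (Finset.map_map f.perm.toEmbedding g.perm.toEmbedding q.X).symm
  have e : ∀ a, (f.basisEquiv q.X).symm ((g.basisEquiv _).symm a) =
      ((f.trans g).basisEquiv q.X).symm (Basis.cast hX.symm a) := fun a => by
    rw [Equiv.symm_apply_eq, Equiv.symm_apply_eq, f.basisEquiv_trans g q.X hX,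
      Equiv.apply_symm_apply]
    rfl
  refine QOp.ext_of_entries hX.symm fun A a b => ?_
  exact congr (congr (congrArg (fun M : Op S q.X => (q.E M : Basis S q.X → Basis S q.X → ℂ))
    (funext fun i => funext fun j => congrArg₂ A (f.basisEquiv_trans g q.X hX i)
      (f.basisEquiv_trans g q.X hX j))) (e a)) (e b)

/-- Factor `f` as `f` followed by the inverse of `g`, then `g`: the first factor fixes `q.X`
pointwise, so only `g` acts. -/
theorem QOp.subst_congr {f g : Subst S} {q : QOp S} (h : ∀ x ∈ q.X, f x = g x) :
    q.subst f = q.subst g := by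
  have h1 : f = (f.trans g.symm).trans g := Subst.ext_apply fun x => by simp
  rw [h1, ← QOp.subst_subst, QOp.subst_of_fix (f.trans g.symm)]
  intro x hx
  simp [h x hx]

namespace Expr

variable {I : Type} {ar : I → ℕ}

theorem subst_id (E : Expr S ar) : E.subst (Subst.id S) = E := by
  induction E with
  | op q E ih => rw [subst, ih, QOp.subst_of_fix _ _ fun _ _ => rfl]
  | _ => simp_all [subst]

theorem subst_subst (f g : Subst S) (E : Expr S ar) :
    (E.subst f).subst g = E.subst (f.trans g) := by
  induction E with
  | op q E ih => simp [subst, ih, QOp.subst_subst]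
  | _ => simp_all [subst]

theorem subst_subst_symm (f : Subst S) (E : Expr S ar) : (E.subst f).subst f.symm = E := by
  rw [subst_subst, Subst.trans_symm, subst_id]

theorem subst_symm_subst (f : Subst S) (E : Expr S ar) : (E.subst f.symm).subst f = E := by
  rw [subst_subst, Subst.symm_trans, subst_id]

theorem finite_fv (E : Expr S ar) : E.fv.Finite := by
  induction E with
  | const A y => exact Set.finite_range y
  | pvar i y => exact Set.finite_range y
  | nil => exact Set.finite_empty
  | tau E ih => exact ih
  | op q E ih => exact ih.union q.X.finite_toSet
  | inp c x E ih => exact ih.sdiff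
  | out c x E ih => exact ih.union (Set.finite_singleton x)
  | sum E F ih1 ih2 => exact ih1.union ih2
  | par E F ih1 ih2 => exact ih1.union ih2
  | res E L ih => exact ih

end Expr

/-! ## The stateless transition system -/

/-- The effect of an action on the state of the environment. -/
def Act.eff : Act S → State S → State S
  | tau, ρ => ρ
  | op q, ρ => q.cyl ρ
  | inp _ _, ρ => ρ
  | out _ _, ρ => ρ

/-- Renaming of the variables in an action. -/
def Act.subst (f : Subst S) : Act S → Act S
  | tau => tau
  | op q => op (q.subst f)
  | inp c x => inp c (f x)
  | out c x => out c (f x)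

theorem Act.subst_symm_subst (f : Subst S) (α : Act S) : (α.subst f.symm).subst f = α := by
  cases α with
  | op q =>
    simp only [subst, QOp.subst_subst, Subst.symm_trans]
    rw [QOp.subst_of_fix _ _ fun _ _ => rfl]
  | _ => simp [subst]

theorem Act.cn_subst (f : Subst S) (α : Act S) : (α.subst f).cn = α.cn := by
  cases α <;> rfl

/-- If `α` is an input `c?x`, then `x` is not in `V`. -/
def Act.Fresh (V : Set S.Var) : Act S → Prop
  | inp _ x => x ∉ V
  | _ => True

theorem Act.Fresh.mono {V W : Set S.Var} {α : Act S} (h : α.Fresh W) (hVW : V ⊆ W) :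
    α.Fresh V := by
  cases α with
  | inp c x => exact fun hx => h (hVW hx)
  | _ => trivial

theorem Act.fresh_of_not_isInput {V : Set S.Var} {α : Act S} (h : ¬ α.IsInput) : α.Fresh V := by
  cases α with
  | inp c x => exact absurd trivial h
  | _ => trivial

/-- The transitions of processes. They do not depend on the state of the environment. -/
inductive Trans (D : Definitions S) : Term S → Act S → Term S → Prop
  | tau (P) : Trans D (.tau P) .tau P
  | oper (q P) : Trans D (.op q P) (.op q) P
  | input (c x P y) (hd : S.dim y = S.dim x) (hy : y ∉ (Expr.inp c x P : Term S).fv) :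
      Trans D (.inp c x P) (.inp c y) (P.subst (Subst.swap x y hd))
  | output (c x P) : Trans D (.out c x P) (.out c x) P
  | choiceL {P Q P' α} : Trans D P α P' → Trans D (.sum P Q) α P'
  | choiceR {P Q Q' α} : Trans D Q α Q' → Trans D (.sum P Q) α Q'
  | intlL {P Q P' α} : Trans D P α P' → α.Fresh Q.fv → Trans D (.par P Q) α (.par P' Q)
  | intlR {P Q Q' α} : Trans D Q α Q' → α.Fresh P.fv → Trans D (.par P Q) α (.par P Q')
  | commL {P Q P' Q' c x} : Trans D P (.inp c x) P' → Trans D Q (.out c x) Q' →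
      Trans D (.par P Q) .tau (.par P' Q')
  | commR {P Q P' Q' c x} : Trans D P (.out c x) P' → Trans D Q (.inp c x) Q' →
      Trans D (.par P Q) .tau (.par P' Q')
  | res {P P' α L} : Trans D P α P' → (∀ c, α.cn = some c → c ∉ L) →
      Trans D (.res P L) α (.res P' L)
  | defn {A y P' α} (f : Subst S) : (∀ k, f (D.params A k) = y k) →
      Trans D ((D.body A).1.subst f) α P' → Trans D (.const A y) α P'

variable {D : Definitions S}

/-- No rule has a premise on the state beyond passing it along, so it can be erased. `Trans.step` is
the converse: a transition can be replayed from any state. -/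
theorem Step.trans {P P' : Term S} {ρ ρ' : State S} {α : Act S} (h : Step D P ρ α P' ρ') :
    Trans D P α P' := by
  induction h with
  | tau P ρ => exact .tau P
  | oper q P ρ => exact .oper q P
  | input c x P ρ y hd hy => exact .input c x P y hd hy
  | output c x P ρ => exact .output c x P
  | choiceL _ ih => exact .choiceL ih
  | choiceR _ ih => exact .choiceR ih
  | intl1L _ hx ih => exact .intlL ih hx
  | intl1R _ hx ih => exact .intlR ih hx
  | intl2L _ hx ih => exact .intlL ih (Act.fresh_of_not_isInput hx)
  | intl2R _ hx ih => exact .intlR ih (Act.fresh_of_not_isInput hx)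
  | commL _ _ ih1 ih2 => exact .commL ih1 ih2
  | commR _ _ ih1 ih2 => exact .commR ih1 ih2
  | res _ hL ih => exact .res ih hL
  | defn f hf _ ih => exact .defn f hf ih

theorem Trans.step {P P' : Term S} {α : Act S} (h : Trans D P α P') (ρ : State S) :
    Step D P ρ α P' (α.eff ρ) := by
  induction h with
  | tau P => exact .tau P ρ
  | oper q P => exact .oper q P ρ
  | input c x P y hd hy => exact .input c x P ρ y hd hy
  | output c x P => exact .output c x P ρ
  | choiceL _ ih => exact .choiceL ih
  | choiceR _ ih => exact .choiceR ih
  | @intlL _ _ _ α _ hx ih =>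
    cases α with
    | inp c x => exact .intl1L ih hx
    | _ => exact .intl2L ih not_false
  | @intlR _ _ _ α _ hx ih =>
    cases α with
    | inp c x => exact .intl1R ih hx
    | _ => exact .intl2R ih not_false
  | commL _ _ ih1 ih2 => exact .commL ih1 ih2
  | commR _ _ ih1 ih2 => exact .commR ih1 ih2
  | res _ hL ih => exact .res ih hL
  | defn f hf _ ih => exact .defn f hf ih

/-! ### Equivariance of transitions under substitution. -/

theorem Act.Fresh.subst {V : Set S.Var} {α : Act S} (h : α.Fresh V) (f : Subst S) :
    (α.subst f).Fresh (f '' V) := by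
  cases α with
  | inp c x =>
    rintro ⟨z, hz, e⟩
    exact h (f.injective e ▸ hz)
  | _ => trivial

theorem Trans.subst (f : Subst S) {P P' : Term S} {α : Act S} (h : Trans D P α P') :
    Trans D (P.subst f) (α.subst f) (P'.subst f) := by
  induction h with
  | tau P => exact .tau _
  | oper q P => exact .oper _ _
  | input c x P y hd hy =>
    have hd' : S.dim (f y) = S.dim (f x) := by rw [f.dim_eq, f.dim_eq, hd]
    rw [Expr.subst_subst, Subst.swap_trans x y hd f hd', ← Expr.subst_subst]
    refine .input c (f x) (P.subst f) (f y) hd' ?_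
    change f y ∉ ((Expr.inp c x P : Term S).subst f).fv
    rw [Expr.fv_subst]
    rintro ⟨z, hz, e⟩
    exact hy (f.injective e ▸ hz)
  | output c x P => exact .output _ _ _
  | choiceL _ ih => exact .choiceL ih
  | choiceR _ ih => exact .choiceR ih
  | intlL _ hx ih => exact .intlL ih (by rw [Expr.fv_subst]; exact hx.subst f)
  | intlR _ hx ih => exact .intlR ih (by rw [Expr.fv_subst]; exact hx.subst f)
  | commL _ _ ih1 ih2 => exact .commL ih1 ih2
  | commR _ _ ih1 ih2 => exact .commR ih1 ih2
  | res _ hL ih => exact .res ih (by rwa [Act.cn_subst])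
  | defn g hg _ ih =>
    -- The rule for constants accepts any substitution with the right values on the parameters, so
    -- the composite is a legitimate choice.
    refine .defn (g.trans f) (fun k => congrArg f (hg k)) ?_
    rwa [Expr.subst_subst] at ih

/-! ### Free variables and well-formedness along transitions. -/

/-- The variables which a process may acquire by performing an action. -/
def Act.gain : Act S → Set S.Var
  | inp _ x => {x}
  | _ => ∅

/-- The variables which a process loses by performing an action. -/
def Act.loss : Act S → Set S.Var
  | out _ x => {x}
  | _ => ∅

theorem Definitions.fv_body_subst {A : S.Const} {y : Fin (S.ar A) → S.Var} {f : Subst S}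
    (h : ∀ k, f (D.params A k) = y k) : ((D.body A).1.subst f).fv ⊆ Set.range y := by
  rw [Expr.fv_subst]
  rintro _ ⟨z, hz, rfl⟩
  obtain ⟨k, rfl⟩ := D.fv_body A hz
  exact ⟨k, (h k).symm⟩

theorem Trans.loss_subset {P P' : Term S} {α : Act S} (h : Trans D P α P') : α.loss ⊆ P.fv := by
  induction h with
  | tau P => exact Set.empty_subset _
  | oper q P => exact Set.empty_subset _
  | input c x P y hd hy => exact Set.empty_subset _
  | output c x P => exact Set.subset_union_right
  | choiceL _ ih => exact ih.trans Set.subset_union_left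
  | choiceR _ ih => exact ih.trans Set.subset_union_right
  | intlL _ hx ih => exact ih.trans Set.subset_union_left
  | intlR _ hx ih => exact ih.trans Set.subset_union_right
  | commL _ _ ih1 ih2 => exact Set.empty_subset _
  | commR _ _ ih1 ih2 => exact Set.empty_subset _
  | res _ hL ih => exact ih
  | defn f hf _ ih => exact ih.trans (D.fv_body_subst hf)

theorem Act.Fresh.disjoint_gain {V : Set S.Var} {α : Act S} (h : α.Fresh V) :
    Disjoint α.gain V := by
  cases α with
  | inp c x => exact Set.disjoint_singleton_left.2 h
  | _ => exact Set.empty_disjoint _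

/-- The two conclusions need each other: disjointness of parallel residuals follows from the bound
on free variables. In a communication the receiver gains exactly the variable that the sender loses,
so the residuals stay disjoint. -/
theorem Trans.wf_and_fv {P P' : Term S} {α : Act S} (h : Trans D P α P') (hP : P.WF) :
    P'.WF ∧ P'.fv ⊆ (P.fv ∪ α.gain) \ α.loss := by
  induction h with
  | tau P => exact ⟨hP, fun z hz => ⟨Or.inl hz, not_false⟩⟩
  | oper q P => exact ⟨hP, fun z hz => ⟨Or.inl (Or.inl hz), not_false⟩⟩
  | input c x P y hd hy =>
    refine ⟨Expr.WF.subst _ hP, ?_⟩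
    rw [Expr.fv_subst]
    rintro _ ⟨z, hz, rfl⟩
    refine ⟨?_, not_false⟩
    rw [Subst.swap_apply]
    split_ifs with h1 h2
    · exact Or.inr rfl
    -- Here `y` would be free in the body and distinct from the bound variable, hence free in the
    -- whole input prefix.
    · exact absurd ⟨h2 ▸ hz, fun e => h1 (h2.trans e)⟩ hy
    · exact Or.inl ⟨hz, h1⟩
  | output c x P => exact ⟨hP.1, fun z hz => ⟨Or.inl (Or.inl hz), fun e => hP.2 (e ▸ hz)⟩⟩
  | choiceL _ ih =>
    exact ⟨(ih hP.1).1, fun z hz => ⟨((ih hP.1).2 hz).1.imp Or.inl _root_.id, ((ih hP.1).2 hz).2⟩⟩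
  | choiceR _ ih =>
    exact ⟨(ih hP.2).1, fun z hz => ⟨((ih hP.2).2 hz).1.imp Or.inr _root_.id, ((ih hP.2).2 hz).2⟩⟩
  | @intlL P Q P' α h hx ih =>
    obtain ⟨h1, h2, h3⟩ := hP
    obtain ⟨w, hv⟩ := ih h1
    rw [← Set.disjoint_iff_inter_eq_empty] at h3
    refine ⟨⟨w, h2, ?_⟩, ?_⟩
    · rw [← Set.disjoint_iff_inter_eq_empty]
      exact (Set.disjoint_union_left.2 ⟨h3, hx.disjoint_gain⟩).mono_left (hv.trans Set.sdiff_subset)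
    · rintro z (hz | hz)
      · exact ⟨(hv hz).1.imp Or.inl _root_.id, (hv hz).2⟩
      · exact ⟨Or.inl (Or.inr hz), fun e => h3.le_bot ⟨h.loss_subset e, hz⟩⟩
  | @intlR P Q Q' α h hx ih =>
    obtain ⟨h1, h2, h3⟩ := hP
    obtain ⟨w, hv⟩ := ih h2
    rw [← Set.disjoint_iff_inter_eq_empty] at h3
    refine ⟨⟨h1, w, ?_⟩, ?_⟩
    · rw [← Set.disjoint_iff_inter_eq_empty]
      exact (Set.disjoint_union_right.2 ⟨h3, hx.disjoint_gain.symm⟩).mono_right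
        (hv.trans Set.sdiff_subset)
    · rintro z (hz | hz)
      · exact ⟨Or.inl (Or.inl hz), fun e => h3.le_bot ⟨hz, h.loss_subset e⟩⟩
      · exact ⟨(hv hz).1.imp Or.inr _root_.id, (hv hz).2⟩
  | @commL P Q P' Q' c x hi ho ih1 ih2 =>
    obtain ⟨h1, h2, h3⟩ := hP
    obtain ⟨w1, hv1⟩ := ih1 h1
    obtain ⟨w2, hv2⟩ := ih2 h2
    have hx : x ∈ Q.fv := ho.loss_subset rfl
    rw [← Set.disjoint_iff_inter_eq_empty] at h3
    refine ⟨⟨w1, w2, ?_⟩, ?_⟩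
    · rw [← Set.disjoint_iff_inter_eq_empty, Set.disjoint_left]
      intro z hz1 hz2
      obtain ⟨h4 | h4, h5⟩ := hv2 hz2
      · rcases (hv1 hz1).1 with h6 | h6
        · exact h3.le_bot ⟨h6, h4⟩
        · exact h5 h6
      · exact h4
    · rintro z (hz | hz)
      · rcases (hv1 hz).1 with h6 | h6
        · exact ⟨Or.inl (Or.inl h6), not_false⟩
        · obtain rfl : z = x := h6
          exact ⟨Or.inl (Or.inr hx), not_false⟩
      · exact ⟨(hv2 hz).1.imp Or.inr _root_.id, not_false⟩
  | @commR P Q P' Q' c x ho hi ih1 ih2 =>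
    obtain ⟨h1, h2, h3⟩ := hP
    obtain ⟨w1, hv1⟩ := ih1 h1
    obtain ⟨w2, hv2⟩ := ih2 h2
    have hx : x ∈ P.fv := ho.loss_subset rfl
    rw [← Set.disjoint_iff_inter_eq_empty] at h3
    refine ⟨⟨w1, w2, ?_⟩, ?_⟩
    · rw [← Set.disjoint_iff_inter_eq_empty, Set.disjoint_left]
      intro z hz1 hz2
      obtain ⟨h4 | h4, h5⟩ := hv1 hz1
      · rcases (hv2 hz2).1 with h6 | h6
        · exact h3.le_bot ⟨h4, h6⟩
        · exact h5 h6
      · exact h4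
    · rintro z (hz | hz)
      · exact ⟨(hv1 hz).1.imp Or.inl _root_.id, not_false⟩
      · rcases (hv2 hz).1 with h6 | h6
        · exact ⟨Or.inl (Or.inr h6), not_false⟩
        · obtain rfl : z = x := h6
          exact ⟨Or.inl (Or.inl hx), not_false⟩
  | res _ hL ih => exact ih hP
  | defn f hf _ ih =>
    obtain ⟨w, hv⟩ := ih ((D.body _).2.subst f)
    exact ⟨w, fun z hz => ⟨(hv hz).1.imp (fun h => D.fv_body_subst hf h) _root_.id, (hv hz).2⟩⟩

/-! ## Congruence closure of a relation on processes -/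

/-- The least transitive congruence on processes containing a given relation and closed under
substitution and alpha-conversion. -/
inductive CongrClosure (B : Term S → Term S → Prop) : Term S → Term S → Prop
  | base (f : Subst S) {P Q : Term S} : B P Q → CongrClosure B (P.subst f) (Q.subst f)
  | alpha (P : Term S) (f g : Subst S) : (∀ x ∈ P.fv, f x = g x) →
      CongrClosure B (P.subst f) (P.subst g)
  | tau {P Q} : CongrClosure B P Q → CongrClosure B (.tau P) (.tau Q)
  | op (q) {P Q} : CongrClosure B P Q → CongrClosure B (.op q P) (.op q Q)
  | inp (c x) {P Q} : CongrClosure B P Q → CongrClosure B (.inp c x P) (.inp c x Q)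
  | out (c x) {P Q} : CongrClosure B P Q → CongrClosure B (.out c x P) (.out c x Q)
  | sum {P P' Q Q'} : CongrClosure B P Q → CongrClosure B P' Q' →
      CongrClosure B (.sum P P') (.sum Q Q')
  | par {P P' Q Q'} : CongrClosure B P Q → CongrClosure B P' Q' →
      CongrClosure B (.par P P') (.par Q Q')
  | res (L) {P Q} : CongrClosure B P Q → CongrClosure B (.res P L) (.res Q L)
  | trans {P Q R : Term S} : Q.WF → CongrClosure B P Q → CongrClosure B Q R → CongrClosure B P R

namespace CongrClosure

variable {B : Term S → Term S → Prop}

theorem of_base {P Q : Term S} (h : B P Q) : CongrClosure B P Q := by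
  simpa only [Expr.subst_id] using CongrClosure.base (Subst.id S) h

theorem refl (P : Term S) : CongrClosure B P P := by
  simpa only [Expr.subst_id] using
    CongrClosure.alpha (B := B) P (Subst.id S) (Subst.id S) fun _ _ => rfl

theorem symm (hB : ∀ P Q, B P Q → B Q P) {P Q : Term S} (h : CongrClosure B P Q) :
    CongrClosure B Q P := by
  induction h with
  | base f h => exact .base f (hB _ _ h)
  | alpha P f g h => exact .alpha P g f fun x hx => (h x hx).symm
  | tau _ ih => exact .tau ih
  | op q _ ih => exact .op q ih
  | inp c x _ ih => exact .inp c x ih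
  | out c x _ ih => exact .out c x ih
  | sum _ _ ih1 ih2 => exact .sum ih1 ih2
  | par _ _ ih1 ih2 => exact .par ih1 ih2
  | res L _ ih => exact .res L ih
  | trans hQ _ _ ih1 ih2 => exact .trans hQ ih2 ih1

/-- `B` itself need not be stable under substitution; the `base` constructor already carries one,
and substitutions compose. -/
theorem subst (f : Subst S) {P Q : Term S} (h : CongrClosure B P Q) :
    CongrClosure B (P.subst f) (Q.subst f) := by
  induction h with
  | base g h =>
    rw [Expr.subst_subst, Expr.subst_subst]
    exact .base _ h
  | alpha P g h e =>
    rw [Expr.subst_subst, Expr.subst_subst]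
    exact .alpha P _ _ fun x hx => congrArg f (e x hx)
  | tau _ ih => exact .tau ih
  | op q _ ih => exact .op _ ih
  | inp c x _ ih => exact .inp _ _ ih
  | out c x _ ih => exact .out _ _ ih
  | sum _ _ ih1 ih2 => exact .sum ih1 ih2
  | par _ _ ih1 ih2 => exact .par ih1 ih2
  | res L _ ih => exact .res L ih
  | trans hQ _ _ ih1 ih2 => exact .trans (hQ.subst f) ih1 ih2

end CongrClosure

/-! ### One-step simulation up to the congruence closure. -/

/-- Every transition of `P` is matched by `Q` up to the congruence closure of `B`, where only
inputs of variables which are free in neither `P` nor `Q` are considered. -/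
def Simulated (D : Definitions S) (B : Term S → Term S → Prop) (P Q : Term S) : Prop :=
  ∀ α P', Trans D P α P' → α.Fresh (P.fv ∪ Q.fv) → ∃ Q', Trans D Q α Q' ∧ CongrClosure B P' Q'

theorem exists_fresh (hfresh : ∀ z : S.Var, {y : S.Var | S.dim y = S.dim z}.Infinite)
    (x : S.Var) {V : Set S.Var} (hV : V.Finite) : ∃ z, S.dim z = S.dim x ∧ z ∉ V := by
  obtain ⟨z, h1, h2⟩ := ((hfresh x).sdiff hV).nonempty
  exact ⟨z, h1, h2⟩

/-- Alpha-convertible processes have the same transitions, up to alpha-conversion. -/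
theorem Trans.alpha {B : Term S → Term S → Prop} (P : Term S) {f g : Subst S}
    (h : ∀ x ∈ P.fv, f x = g x) {α : Act S} {P' : Term S} (ht : Trans D (P.subst f) α P') :
    ∃ Q', Trans D (P.subst g) α Q' ∧ CongrClosure B P' Q' := by
  have hfv : ∀ {P : Term S}, (∀ x ∈ P.fv, f x = g x) → (P.subst g).fv = (P.subst f).fv := by
    intro P h
    rw [Expr.fv_subst, Expr.fv_subst]
    exact (Set.image_congr h).symm
  induction P generalizing α P' with
  | const A y =>
    -- All arguments of a constant are free, so the two instances coincide and the definition need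
    -- not be unfolded; this is why structural induction suffices.
    have e : (Expr.const A y : Term S).subst f = (Expr.const A y : Term S).subst g :=
      congrArg (Expr.const A) (funext fun k => h _ ⟨k, rfl⟩)
    exact ⟨P', e ▸ ht, .refl _⟩
  | pvar i => exact i.elim
  | nil => cases ht
  | tau P ih =>
    cases ht
    exact ⟨_, .tau _, .alpha P f g h⟩
  | op q P ih =>
    cases ht
    refine ⟨_, ?_, .alpha P f g fun x hx => h x (Or.inl hx)⟩
    rw [QOp.subst_congr fun x hx => h x (Or.inr hx)]
    exact .oper _ _
  | inp c x P ih =>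
    cases ht with
    | input c _ _ y hd hy =>
      have e := hfv h
      change y ∉ ((Expr.inp c x P : Term S).subst f).fv at hy
      have hd' : S.dim y = S.dim (g x) := by rw [hd, f.dim_eq, g.dim_eq]
      refine ⟨_, .input c (g x) (P.subst g) y hd' (e ▸ hy), ?_⟩
      rw [Expr.subst_subst, Expr.subst_subst]
      refine .alpha P _ _ fun z hz => ?_
      -- The bound variable may have different images under `f` and `g`, but both are exchanged with
      -- the received `y`. Other free variables of the body have equal images, which differ from `y`
      -- by the freshness of `y`.
      simp only [Subst.trans_apply, Subst.swap_apply, f.injective.eq_iff, g.injective.eq_iff]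
      rcases eq_or_ne z x with rfl | hzx
      · simp
      · have h1 : f z = g z := h z ⟨hz, hzx⟩
        have h2 : f z ≠ y := by
          rintro rfl
          rw [Expr.fv_subst] at hy
          exact hy ⟨z, ⟨hz, hzx⟩, rfl⟩
        rw [← h1, if_neg hzx, if_neg hzx, if_neg h2, if_neg h2]
  | out c x P ih =>
    cases ht
    refine ⟨_, ?_, .alpha P f g fun x hx => h x (Or.inl hx)⟩
    rw [h x (Or.inr rfl)]
    exact .output _ _ _
  | sum P Q ih1 ih2 =>
    cases ht with
    | choiceL ht =>
      obtain ⟨Q', h1, h2⟩ := ih1 (fun x hx => h x (Or.inl hx)) ht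
      exact ⟨Q', .choiceL h1, h2⟩
    | choiceR ht =>
      obtain ⟨Q', h1, h2⟩ := ih2 (fun x hx => h x (Or.inr hx)) ht
      exact ⟨Q', .choiceR h1, h2⟩
  | par P Q ih1 ih2 =>
    have hP : ∀ x ∈ P.fv, f x = g x := fun x hx => h x (Or.inl hx)
    have hQ : ∀ x ∈ Q.fv, f x = g x := fun x hx => h x (Or.inr hx)
    cases ht with
    | intlL ht hx =>
      obtain ⟨Q', h1, h2⟩ := ih1 hP ht
      exact ⟨_, .intlL h1 (by rwa [hfv hQ]), .par h2 (.alpha Q f g hQ)⟩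
    | intlR ht hx =>
      obtain ⟨Q', h1, h2⟩ := ih2 hQ ht
      exact ⟨_, .intlR h1 (by rwa [hfv hP]), .par (.alpha P f g hP) h2⟩
    | commL ht1 ht2 =>
      obtain ⟨P', h1, h2⟩ := ih1 hP ht1
      obtain ⟨Q', h3, h4⟩ := ih2 hQ ht2
      exact ⟨_, .commL h1 h3, .par h2 h4⟩
    | commR ht1 ht2 =>
      obtain ⟨P', h1, h2⟩ := ih1 hP ht1
      obtain ⟨Q', h3, h4⟩ := ih2 hQ ht2
      exact ⟨_, .commR h1 h3, .par h2 h4⟩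
  | res P L ih =>
    cases ht with
    | res ht hL =>
      obtain ⟨Q', h1, h2⟩ := ih h ht
      exact ⟨_, .res h1 hL, .res L h2⟩

/-- The variable received in an input transition can be replaced by another fresh one. -/
theorem Trans.rename_input {B : Term S → Term S → Prop} {P P' : Term S} {c : S.Chan}
    {x z : S.Var} (hd : S.dim z = S.dim x) (ht : Trans D P (.inp c x) P') (hx : x ∉ P.fv)
    (hz : z ∉ P.fv) :
    ∃ P₁, Trans D P (.inp c z) P₁ ∧ CongrClosure B (P'.subst (Subst.swap x z hd)) P₁ := by
  have h := ht.subst (Subst.swap x z hd)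
  have e : (Act.inp c x).subst (Subst.swap x z hd) = .inp c z := by
    simp [Act.subst, Subst.swap_apply]
  rw [e] at h
  -- Neither `x` nor `z` is free in `P`, so the swap only renames bound variables of `P`, and the
  -- renamed transition can be transported back to `P` itself.
  obtain ⟨P₁, h1, h2⟩ := Trans.alpha (B := B) P (g := Subst.id S) (fun y hy => by
    rw [Subst.swap_apply, if_neg (show y ≠ x by rintro rfl; exact hx hy),
      if_neg (show y ≠ z by rintro rfl; exact hz hy)]
    rfl) h
  exact ⟨P₁, by rwa [Expr.subst_id] at h1, h2⟩

namespace Simulated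

variable {B : Term S → Term S → Prop} {P P' Q Q' R : Term S}

theorem alpha (P : Term S) (f g : Subst S) (h : ∀ x ∈ P.fv, f x = g x) :
    Simulated D B (P.subst f) (P.subst g) := fun _ _ ht _ => Trans.alpha P h ht

theorem refl (P : Term S) : Simulated D B P P := fun _ P' ht _ => ⟨P', ht, .refl P'⟩

theorem tau (h : CongrClosure B P Q) : Simulated D B (.tau P) (.tau Q) := by
  intro α P' ht _
  cases ht
  exact ⟨_, .tau _, h⟩

theorem op (q : QOp S) (h : CongrClosure B P Q) : Simulated D B (.op q P) (.op q Q) := by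
  intro α P' ht _
  cases ht
  exact ⟨_, .oper _ _, h⟩

theorem inp (c : S.Chan) (x : S.Var) (h : CongrClosure B P Q) :
    Simulated D B (.inp c x P) (.inp c x Q) := by
  intro α P' ht hf
  cases ht with
  | input _ _ _ y hd hy => exact ⟨_, .input c x Q y hd fun h => hf (Or.inr h), h.subst _⟩

theorem out (c : S.Chan) (x : S.Var) (h : CongrClosure B P Q) :
    Simulated D B (.out c x P) (.out c x Q) := by
  intro α P' ht _
  cases ht
  exact ⟨_, .output _ _ _, h⟩

theorem sum (h : Simulated D B P Q) (h' : Simulated D B P' Q') :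
    Simulated D B (.sum P P') (.sum Q Q') := by
  intro α R ht hf
  cases ht with
  | choiceL ht =>
    obtain ⟨Q', h1, h2⟩ := h _ _ ht
      (hf.mono (Set.union_subset_union Set.subset_union_left Set.subset_union_left))
    exact ⟨Q', .choiceL h1, h2⟩
  | choiceR ht =>
    obtain ⟨Q', h1, h2⟩ := h' _ _ ht
      (hf.mono (Set.union_subset_union Set.subset_union_right Set.subset_union_right))
    exact ⟨Q', .choiceR h1, h2⟩

/-- A component that stays idle contributes its closure hypothesis instead of a simulation.
Well-formedness is needed for communications, where it supplies the freshness of the received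
variable. -/
theorem par (hP : (Expr.par P P' : Term S).WF) (hQ : (Expr.par Q Q' : Term S).WF)
    (hc : CongrClosure B P Q) (hc' : CongrClosure B P' Q')
    (h : Simulated D B P Q) (h' : Simulated D B P' Q') :
    Simulated D B (.par P P') (.par Q Q') := by
  have hPd := Set.disjoint_iff_inter_eq_empty.2 hP.2.2
  have hQd := Set.disjoint_iff_inter_eq_empty.2 hQ.2.2
  intro α R ht hf
  cases ht with
  | intlL ht hx =>
    obtain ⟨Q₁, h1, h2⟩ := h _ _ ht
      (hf.mono (Set.union_subset_union Set.subset_union_left Set.subset_union_left))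
    -- The side condition concerns the idle component on the matching side, whose free variables may
    -- differ from those of its counterpart; it comes from freshness for the whole right-hand term,
    -- not from `hx`.
    exact ⟨_, .intlL h1 (hf.mono (Set.subset_union_right.trans Set.subset_union_right)),
      .par h2 hc'⟩
  | intlR ht hx =>
    obtain ⟨Q₁, h1, h2⟩ := h' _ _ ht
      (hf.mono (Set.union_subset_union Set.subset_union_right Set.subset_union_right))
    exact ⟨_, .intlR h1 (hf.mono (Set.subset_union_left.trans Set.subset_union_right)),
      .par hc h2⟩
  | commL ht1 ht2 =>
    -- The output is matched first: the matching sender then owns the variable as well, so by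
    -- disjointness it is free in neither receiver, as matching the input requires.
    obtain ⟨Q₂, h3, h4⟩ := h' _ _ ht2 trivial
    obtain ⟨Q₁, h1, h2⟩ := h _ _ ht1 fun hx => hx.elim
      (fun hx => hPd.le_bot ⟨hx, ht2.loss_subset rfl⟩)
      (fun hx => hQd.le_bot ⟨hx, h3.loss_subset rfl⟩)
    exact ⟨_, .commL h1 h3, .par h2 h4⟩
  | commR ht1 ht2 =>
    obtain ⟨Q₁, h1, h2⟩ := h _ _ ht1 trivial
    obtain ⟨Q₂, h3, h4⟩ := h' _ _ ht2 fun hx => hx.elim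
      (fun hx => hPd.le_bot ⟨ht1.loss_subset rfl, hx⟩)
      (fun hx => hQd.le_bot ⟨h1.loss_subset rfl, hx⟩)
    exact ⟨_, .commR h1 h3, .par h2 h4⟩

theorem res (L : Set S.Chan) (h : Simulated D B P Q) : Simulated D B (.res P L) (.res Q L) := by
  intro α R ht hf
  cases ht with
  | res ht hL =>
    obtain ⟨Q₁, h1, h2⟩ := h _ _ ht hf
    exact ⟨_, .res h1 hL, .res L h2⟩

/-- Substitutions are invertible: pull the transition back along `f.symm`, match it there, and push
the answer forward. -/
theorem subst (f : Subst S) (h : Simulated D B P Q) :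
    Simulated D B (P.subst f) (Q.subst f) := by
  intro α R ht hf
  have ht' := ht.subst f.symm
  rw [Expr.subst_subst_symm] at ht'
  have hf' := hf.subst f.symm
  rw [Set.image_union, ← Expr.fv_subst, ← Expr.fv_subst, Expr.subst_subst_symm,
    Expr.subst_subst_symm] at hf'
  obtain ⟨Q', h1, h2⟩ := h _ _ ht' hf'
  have h1' := h1.subst f
  have h2' := h2.subst f
  rw [Act.subst_symm_subst] at h1'
  rw [Expr.subst_symm_subst] at h2'
  exact ⟨_, h1', h2'⟩

/-- Composing is immediate when the label is fresh for all three terms. An input variable is only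
known to be fresh for the outer two, so the input is first renamed to a variable fresh for the
middle one too, and the answer is renamed back. -/
theorem trans (hfresh : ∀ z : S.Var, {y : S.Var | S.dim y = S.dim z}.Infinite)
    (hP : P.WF) (hQ : Q.WF) (hR : R.WF)
    (h : Simulated D B P Q) (h' : Simulated D B Q R) : Simulated D B P R := by
  have key : ∀ α P', Trans D P α P' → α.Fresh (P.fv ∪ Q.fv ∪ R.fv) →
      ∃ R', Trans D R α R' ∧ CongrClosure B P' R' := by
    intro α P' ht hf
    obtain ⟨Q', h1, h2⟩ := h _ _ ht (hf.mono Set.subset_union_left)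
    obtain ⟨R', h3, h4⟩ := h' _ _ h1
      (hf.mono (Set.union_subset_union_left _ Set.subset_union_right))
    exact ⟨R', h3, .trans (h1.wf_and_fv hQ).1 h2 h4⟩
  intro α P' ht hf
  cases α with
  | inp c x =>
    obtain ⟨z, hd, hz⟩ := exists_fresh hfresh x
      ((P.finite_fv.union Q.finite_fv).union R.finite_fv)
    obtain ⟨P₁, h1, h2⟩ := ht.rename_input (B := B) hd (fun h => hf (Or.inl h))
      (fun h => hz (Or.inl (Or.inl h)))
    obtain ⟨R₁, h3, h4⟩ := key _ _ h1 hz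
    obtain ⟨R', h5, h6⟩ := h3.rename_input (B := B) hd.symm (fun h => hz (Or.inr h))
      (fun h => hf (Or.inr h))
    refine ⟨R', h5, ?_⟩
    have wP := (h1.wf_and_fv hP).1
    have wR := (h3.wf_and_fv hR).1
    -- Undoing the swap restores `P'` exactly on the left; on the right, `h6` absorbs the remaining
    -- alpha-conversion.
    have h7 := (CongrClosure.trans wP h2 h4).subst (Subst.swap z x hd.symm)
    rw [Expr.subst_subst, Subst.swap_trans_swap, Expr.subst_id] at h7
    exact .trans (wR.subst _) h7 h6
  | tau => exact key _ _ ht trivial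
  | op q => exact key _ _ ht trivial
  | out c x => exact key _ _ ht trivial

end Simulated

/-- Induction on the closure. Prefixes need only the relation between their bodies, not its
simulation. The middle term of a transitivity step is well-formed by construction of the closure,
which lets the induction hypotheses apply. -/
theorem CongrClosure.simulated
    (hfresh : ∀ z : S.Var, {y : S.Var | S.dim y = S.dim z}.Infinite)
    {B : Term S → Term S → Prop}
    (hsim : ∀ P Q, B P Q → Simulated D B P Q) {P Q : Term S} (h : CongrClosure B P Q)
    (hP : P.WF) (hQ : Q.WF) : Simulated D B P Q := by
  induction h with
  | base f h => exact (hsim _ _ h).subst f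
  | alpha P f g h => exact .alpha P f g h
  | tau h _ => exact .tau h
  | op q h _ => exact .op q h
  | inp c x h _ => exact .inp c x h
  | out c x h _ => exact .out c x h
  | sum _ _ ih1 ih2 => exact .sum (ih1 hP.1 hQ.1) (ih2 hP.2 hQ.2)
  | par h1 h2 ih1 ih2 => exact .par hP hQ h1 h2 (ih1 hP.1 hQ.1) (ih2 hP.2.1 hQ.2.1)
  | res L _ ih => exact .res L (ih hP hQ)
  | trans hR _ _ ih1 ih2 => exact .trans hfresh hP hR hQ (ih1 hP hR) (ih2 hR hQ)

theorem CongrClosure.configBisimilar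
    (hfresh : ∀ z : S.Var, {y : S.Var | S.dim y = S.dim z}.Infinite)
    {B : Term S → Term S → Prop} (hB : ∀ P Q, B P Q → B Q P)
    (hsim : ∀ P Q, B P Q → Simulated D B P Q) {P Q : Proc S} (h : CongrClosure B P.1 Q.1)
    (ρ σ : State S) : ConfigBisimilar D (P, ρ) (Q, σ) := by
  -- The bisimulation ignores states altogether; the quantifier over received variables in its input
  -- clause is then met by closure under substitution.
  refine ⟨fun C C' => CongrClosure B C.1.1 C'.1.1, ⟨fun C C' h => h.symm hB, ?_⟩, h⟩
  intro P Q ρ σ h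
  have hs := h.simulated hfresh hsim P.2 Q.2
  refine ⟨fun α P' ρ' hα ht => ?_, fun c x P' ht hx => ?_⟩
  · obtain ⟨Q', h1, h2⟩ := hs _ _ ht.trans (Act.fresh_of_not_isInput hα)
    exact ⟨⟨Q', (h1.wf_and_fv Q.2).1⟩, _, h1.step σ, h2⟩
  · obtain ⟨Q', h1, h2⟩ := hs _ _ ht.trans hx
    exact ⟨⟨Q', (h1.wf_and_fv Q.2).1⟩, h1.step σ, fun y hd _ => h2.subst _⟩

/-! ### Bisimilarity as a relation on terms. -/

/-- Well-formed terms related by strong bisimilarity in some states. -/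
def TermBisimilar (D : Definitions S) (P Q : Term S) : Prop :=
  ∃ (hP : P.WF) (hQ : Q.WF) (ρ σ : State S), ConfigBisimilar D (⟨P, hP⟩, ρ) (⟨Q, hQ⟩, σ)

theorem TermBisimilar.symm {P Q : Term S} (h : TermBisimilar D P Q) : TermBisimilar D Q P := by
  obtain ⟨hP, hQ, ρ, σ, R, hR, h⟩ := h
  exact ⟨hQ, hP, σ, ρ, R, hR, hR.1 _ _ h⟩

/-- The transition is replayed in the states that witness bisimilarity. The residuals are bisimilar
in the resulting states, which is why `TermBisimilar` quantifies the states existentially. -/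
theorem TermBisimilar.simulated {B : Term S → Term S → Prop}
    (hB : ∀ P Q, TermBisimilar D P Q → B P Q) {P Q : Term S} (h : TermBisimilar D P Q) :
    Simulated D B P Q := by
  obtain ⟨hP, hQ, ρ, σ, R, hR, h⟩ := h
  intro α P' ht hf
  have wP := (ht.wf_and_fv hP).1
  obtain ⟨h1, h2⟩ := hR.2 _ _ _ _ h
  by_cases hα : α.IsInput
  · cases α with
    | inp c x =>
      obtain ⟨Q', h3, h4⟩ := h2 c x ⟨P', wP⟩ (ht.step ρ) hf
      refine ⟨Q'.1, h3.trans, .of_base (hB _ _ ⟨wP, Q'.2, ρ, σ, R, hR, ?_⟩)⟩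
      have e : ∀ A : Proc S, A.subst (Subst.swap x x rfl) = A := fun A => by
        rw [Subst.swap_self]
        exact Subtype.ext A.1.subst_id
      have e' : ∀ A C : Proc S, R (A.subst (Subst.swap x x rfl), ρ)
          (C.subst (Subst.swap x x rfl), σ) → R (A, ρ) (C, σ) := fun A C h => by rwa [e, e] at h
      -- The instance `y = x` is always admissible, and its swap is the identity, so the residuals
      -- themselves are related.
      exact e' _ _ (h4 x rfl fun h => h.2 rfl)
    | tau => exact hα.elim
    | op q => exact hα.elim
    | out c x => exact hα.elim
  · obtain ⟨Q', σ', h3, h4⟩ := h1 α ⟨P', wP⟩ _ hα (ht.step ρ)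
    exact ⟨Q'.1, h3.trans, .of_base (hB _ _ ⟨wP, Q'.2, _, σ', R, hR, h4⟩)⟩

/-! ## Unique solutions of equations -/

section replace

variable {I : Type} {ar : I → ℕ} {x : (i : I) → Fin (ar i) → S.Var} {P Q : I → Proc S}
  {B : Term S → Term S → Prop}

theorem CongrClosure.replace (h : ∀ i, B (P i).1 (Q i).1) (E : Expr S ar) :
    CongrClosure B (E.replace x P) (E.replace x Q) := by
  induction E with
  | const A y => exact .refl _
  | pvar i y => exact .base _ (h i)
  | nil => exact .refl _
  | tau E ih => exact .tau ih
  | op q E ih => exact .op q ih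
  | inp c z E ih => exact .inp c z ih
  | out c z E ih => exact .out c z ih
  | sum E F ih1 ih2 => exact .sum ih1 ih2
  | par E F ih1 ih2 => exact .par ih1 ih2
  | res E L ih => exact .res L ih

/-- Guardedness excludes a process variable at the top level, so `B`-pairs are met only under a
prefix. There the first step is the prefix itself, and congruence relates what remains; no
simulation between `P i` and `Q i` is presupposed. -/
theorem Simulated.replace (hB : ∀ i, B (P i).1 (Q i).1) {E : Expr S ar}
    (hg : ∀ i, E.WeaklyGuarded i) (hP : (E.replace x P).WF) (hQ : (E.replace x Q).WF) :
    Simulated D B (E.replace x P) (E.replace x Q) := by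
  induction E with
  | const A y => exact .refl _
  | pvar i y => exact absurd rfl (hg i)
  | nil => exact .refl _
  | tau E ih => exact .tau (.replace hB E)
  | op q E ih => exact .op q (.replace hB E)
  | inp c z E ih => exact .inp c z (.replace hB E)
  | out c z E ih => exact .out c z (.replace hB E)
  | sum E F ih1 ih2 =>
    exact .sum (ih1 (fun i => (hg i).1) hP.1 hQ.1) (ih2 (fun i => (hg i).2) hP.2 hQ.2)
  | par E F ih1 ih2 =>
    exact .par hP hQ (.replace hB E) (.replace hB F) (ih1 (fun i => (hg i).1) hP.1 hQ.1)
      (ih2 (fun i => (hg i).2) hP.2.1 hQ.2.1)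
  | res E L ih => exact .res L (ih hg hP hQ)

end replace

end QCCS

/-- Uniqueness of solutions of equations up to strong bisimilarity. Here `E i` is a process
expression containing at most the process variable schemes `𝐗_j`, `j : Fin m`, of arity `ar j`, and
`x j` is the tuple of formal parameters of `𝐗_j`. The hypothesis `hfresh` says that fresh variables
of each type are always available. -/
theorem proposition4p4 (S : QCCS.Signature) (D : QCCS.Definitions S)
    (hfresh : ∀ z : S.Var, {y : S.Var | S.dim y = S.dim z}.Infinite)
    (m : ℕ) (ar : Fin m → ℕ)
    (x : (i : Fin m) → Fin (ar i) → S.Var) (hx : ∀ i, Function.Injective (x i))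
    (E : Fin m → QCCS.Expression S ar) (hE : ∀ i, (E i).1.Typed x)
    (hguard : ∀ i j, (E j).1.WeaklyGuarded i)
    (P Q : Fin m → QCCS.Proc S)
    (hP : ∀ i, (P i).fv ⊆ Set.range (x i)) (hQ : ∀ i, (Q i).fv ⊆ Set.range (x i))
    (hPE : ∀ i, QCCS.Bisimilar D (P i) ((E i).replace x hx (hE i) P hP))
    (hQE : ∀ i, QCCS.Bisimilar D (Q i) ((E i).replace x hx (hE i) Q hQ)) :
    ∀ i, QCCS.Bisimilar D (P i) (Q i) := by
  intro i ρ
  let B : QCCS.Term S → QCCS.Term S → Prop := fun A A' =>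
    QCCS.TermBisimilar D A A' ∨ ∃ j, (A = (P j).1 ∧ A' = (Q j).1) ∨ (A = (Q j).1 ∧ A' = (P j).1)
  have hB : ∀ A A', B A A' → B A' A := by
    rintro A A' (h | ⟨j, h | h⟩)
    · exact Or.inl h.symm
    · exact Or.inr ⟨j, Or.inr h.symm⟩
    · exact Or.inr ⟨j, Or.inl h.symm⟩
  have hsim : ∀ (P Q : Fin m → QCCS.Proc S) (hP : ∀ i, (P i).fv ⊆ Set.range (x i))
      (hQ : ∀ i, (Q i).fv ⊆ Set.range (x i)),
      (∀ i, QCCS.Bisimilar D (P i) ((E i).replace x hx (hE i) P hP)) →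
      (∀ i, QCCS.Bisimilar D (Q i) ((E i).replace x hx (hE i) Q hQ)) →
      (∀ j, B (P j).1 (Q j).1) → ∀ j, QCCS.Simulated D B (P j).1 (Q j).1 := by
    intro P Q hP hQ hPE hQE h j
    have wP := ((E j).replace x hx (hE j) P hP).2
    have wQ := ((E j).replace x hx (hE j) Q hQ).2
    have h1 : QCCS.TermBisimilar D (P j).1 ((E j).1.replace x P) :=
      ⟨(P j).2, wP, ρ, ρ, hPE j ρ⟩
    have h2 : QCCS.TermBisimilar D (Q j).1 ((E j).1.replace x Q) :=
      ⟨(Q j).2, wQ, ρ, ρ, hQE j ρ⟩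
    -- The chain runs from P_j through E_j{P} and E_j{Q} to Q_j. It is stated for arbitrary families
    -- so that exchanging `P` and `Q` gives the reverse pairs of `B`.
    exact ((h1.simulated fun _ _ => Or.inl).trans hfresh (P j).2 wP wQ
      (.replace h (fun k => hguard k j) wP wQ)).trans hfresh (P j).2 wQ (Q j).2
      (h2.symm.simulated fun _ _ => Or.inl)
  refine QCCS.CongrClosure.configBisimilar hfresh hB ?_
    (.of_base (Or.inr ⟨i, Or.inl ⟨rfl, rfl⟩⟩)) ρ ρ
  rintro A A' (h | ⟨j, ⟨rfl, rfl⟩ | ⟨rfl, rfl⟩⟩)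
  · exact h.simulated fun _ _ => Or.inl
  · exact hsim P Q hP hQ hPE hQE (fun k => Or.inr ⟨k, Or.inl ⟨rfl, rfl⟩⟩) j
  · exact hsim Q P hQ hP hQE hPE (fun k => Or.inr ⟨k, Or.inr ⟨rfl, rfl⟩⟩) j
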